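/- A Dyck path of length $2N$ is a lattice path from $(0,0)$ to $(2N,0)$ with steps $(1,1)$ and $(1,-1)$ that never goes below the $x$-axis. A path diagram is a Dyck path $u_1u_2\cdots u_{2N}$ together with integers $s_1,\dots,s_{2N}$ (column heights) such that $0\le s_j\le h_j$, where $h_j$ is the height at which the step $u_j$ starts. Let $a_{N,m}$ be the number of path diagrams with Dyck path of length $2N$ and $s_1+\cdots+s_{2N}=m$, and let $a^{(w)}_{N,m}$ be the number of those whose Dyck path never exceeds height $w$. Put $$G(t,q)=\sum_{N,m\ge 0}a_{N,m}t^{2N}q^m,\qquad G_w(t,q)=\sum_{N,m\ge 0}a^{(w)}_{N,m}t^{2N}q^m .$$ With $[k]_q=1+q+\cdots+q^{k-1}$, the $q$-tangent numbers $E_{2N+1}(q)$ are defined by the formal power series expansion $$\sum_{N\ge0}E_{2N+1}(q)\,t^{2N+1}=\cfrac{t}{1-\cfrac{[1]_q[2]_q\,t^2}{1-\cfrac{[2]_q[3]_q\,t^2}{\ddots}}}\ .$$ Let $q,t\in\mathbb C$ with $|q|<1$ and $0<|t|<(1-|q|)/2$, and let $\lambda$ be the root of $\lambda^2-\lambda(1-q)/t+1=0$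 of smallest modulus. Then all the series involved (the double series $G(t,q)$ and $G_w(t,q)$ for every $w\ge0$, the series $\sum_N E_{2N+1}(q)t^{2N}$, and the series on the right below) converge absolutely, and $$\lim_{w\to\infty}G_w(t,q)=G(t,q)=\sum_{N\ge0}E_{2N+1}(q)\,t^{2N}=\frac{(1+\lambda^2)\left[1-(1+\lambda^2)\displaystyle\sum_{k=0}^{\infty}\frac{(-i\lambda)^k}{1-i\lambda q^k}\right]}{\lambda^2(1-q)} .$$ -/

import Mathlib

/-! ### Path diagrams

A Dyck path is a `DyckWord`: `U` is a northeast step, `D` a southeast step.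
A labelled step `a_j` is `U` together with the height `j` at which it starts, and `b_k` is `D`
together with the height `k` at which it starts. -/

/-- The height of the Dyck path `p` after its first `i` steps. -/
def DyckWord.heightAt (p : DyckWord) (i : ℕ) : ℕ :=
  (p.toList.take i).count DyckStep.U - (p.toList.take i).count DyckStep.D

/-- The possibility function `pos(a_j) = j`, `pos(b_k) = k`. -/
def tangentPos : DyckStep → ℕ → ℕ
  | DyckStep.U, j => j
  | DyckStep.D, k => k

/-- A path diagram for the possibility function `pos`: a Dyck path `u_1 u_2 ... u_n` and integers
`0 ≤ s_i ≤ pos(u_i)`, one for each step (the column heights). -/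
structure PathDiagram (pos : DyckStep → ℕ → ℕ) where
  path : DyckWord
  column : Fin path.toList.length → ℕ
  column_le : ∀ i, column i ≤ pos (path.toList.get i) (path.heightAt i)

/-- The sum of the column heights. -/
def PathDiagram.area {pos : DyckStep → ℕ → ℕ} (d : PathDiagram pos) : ℕ :=
  ∑ i, d.column i

/-- The number of path diagrams for `tangentPos` whose Dyck path has length `2 * N` and whose
column heights sum to `m`. -/
noncomputable def tangentCount (N m : ℕ) : ℕ :=
  Nat.card {d : PathDiagram tangentPos // d.path.semilength = N ∧ d.area = m}

/-- The number of those path diagrams whose Dyck path stays in the slit of width `w`. -/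
noncomputable def tangentSlitCount (w N m : ℕ) : ℕ :=
  Nat.card {d : PathDiagram tangentPos //
    d.path.semilength = N ∧ d.area = m ∧ ∀ i, d.path.heightAt i ≤ w}

/-! ### `q`-tangent numbers -/

/-- The `q`-integer `1 + q + ... + q ^ (k - 1) = (1 - q ^ k) / (1 - q)` as a polynomial in `q`. -/
noncomputable def qInteger (k : ℕ) : Polynomial ℤ :=
  ∑ j ∈ Finset.range k, Polynomial.X ^ j

/-- With `[k]` the `q`-integer, the finite continued fraction with `n` partial quotients
`1 / (1 - [k] [k+1] t ^ 2 / (1 - [k+1] [k+2] t ^ 2 / (... / (1 - [k+n-1] [k+n] t ^ 2))))`,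
a formal power series in `t`. The series that is inverted has constant coefficient `1`. -/
noncomputable def qTangentFraction : ℕ → ℕ → PowerSeries (Polynomial ℤ)
  | _, 0 => 1
  | k, n + 1 =>
    PowerSeries.invOfUnit
      (1 - PowerSeries.C (qInteger k * qInteger (k + 1)) * PowerSeries.X ^ 2 *
        qTangentFraction (k + 1) n) 1

/-- The `q`-tangent number `E_{2N+1}(q)`: the coefficient of `t ^ (2 N + 1)` in the infinite
continued fraction `t / (1 - [1] [2] t ^ 2 / (1 - [2] [3] t ^ 2 / ...))`. The convergents with at
least `N` partial quotients all have the same coefficient there. -/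
noncomputable def qTangentNumber (N : ℕ) : Polynomial ℤ :=
  PowerSeries.coeff (2 * N + 1) (PowerSeries.X * qTangentFraction 1 N)

/-! ### The closed form -/

/-- `(1 + l ^ 2) [1 - (1 + l ^ 2) ∑ (-i l) ^ k / (1 - i l q ^ k)] / (l ^ 2 (1 - q))`. -/
noncomputable def qTangentClosedForm (q l : ℂ) : ℂ :=
  (1 + l ^ 2) *
    (1 - (1 + l ^ 2) * ∑' k : ℕ, (-Complex.I * l) ^ k / (1 - Complex.I * l * q ^ k)) /
    (l ^ 2 * (1 - q))

/-! ### Weighted Dyck paths and the first-return recursion -/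

open Filter Topology

/-! For a fixed Dyck path, summing q^area over the columns gives the product of [h + 1] over the
starting heights h. Splitting at the first return to the starting level (the binary tree of a Dyck
word) gives, for the series F_h of paths based at height h, F_h = 1 + [h+1][h+2] t^2 F_{h+1} F_h.
This is the continued fraction of the q-tangent numbers, with slit width as depth of the convergent.
Since |[k]| ≤ 1/(1-|q|) and Catalan numbers are at most 4^N, everything is dominated by a geometric
series of ratio (2|t|/(1-|q|))^2 < 1, which gives the convergence and the limit in w.

For the closed form put a = iλ and let W_k be `heineSum`. Its three-term relation
`heineSum_contiguous`, together with λ(1-q) = (1+λ^2)t, says that (1+λ^2) W_{h+1} / ((1-q^{h+1})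
W_h) formally obeys the recursion of F_h. Because W_h might vanish, `pathSeries_mul_heineSum` works
instead with the defect D_h = F_h (1-q^{h+1}) W_h - (1+λ^2) W_{h+1}. It is bounded in h and |D_h| ≤
|λ| |D_{h+1}| with |λ| < 1, so D_0 = 0. Evaluating W_0 and W_1 finishes the proof. -/

open DyckStep in
/-- The product of the `q`-integers `[h + 1]` over the starting heights `h` of the steps of a lattice
path that starts at height `h`, or `0` if the path exceeds the height `b`. -/
def pathWeight {R : Type*} [CommSemiring R] (q : R) (b : ℕ) : ℕ → List DyckStep → R
  | _, [] => 1
  | h, U :: l => (∑ j ∈ Finset.range (h + 1), q ^ j) *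
      if h + 1 ≤ b then pathWeight q b (h + 1) l else 0
  | h, D :: l => (∑ j ∈ Finset.range (h + 1), q ^ j) * pathWeight q b (h - 1) l

/-- The weight of the Dyck path of a binary tree in a slit of width `w`, when the path starts at
height `h` above the bottom line and the slit is measured from there. -/
def treeWeight {R : Type*} [CommSemiring R] (q : R) : ℕ → ℕ → BinaryTree Unit → R
  | _, _, .nil => 1
  | 0, _, .node _ _ _ => 0
  | w + 1, h, .node _ l r =>
    (∑ j ∈ Finset.range (h + 1), q ^ j) * (∑ j ∈ Finset.range (h + 2), q ^ j) *
      treeWeight q w (h + 1) l * treeWeight q (w + 1) h r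

/-- The weighted number of Dyck paths of semilength `N` in a slit of width `w`, starting at
height `h`. -/
def slitSum {R : Type*} [CommSemiring R] (q : R) (w h N : ℕ) : R :=
  ∑ x ∈ BinaryTree.treesOfNumNodesEq N, treeWeight q w h x

section
variable {R S : Type*} [CommSemiring R] [CommSemiring S]

theorem map_treeWeight (f : R →+* S) (q : R) (x : BinaryTree Unit) :
    ∀ w h, f (treeWeight q w h x) = treeWeight (f q) w h x := by
  induction x with
  | nil => intro w h; simp [treeWeight]
  | node _ l r ihl ihr =>
    intro w h
    cases w with
    | zero => simp [treeWeight]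
    | succ w => simp [treeWeight, ihl, ihr]

theorem map_slitSum (f : R →+* S) (q : R) (w h N : ℕ) :
    f (slitSum q w h N) = slitSum (f q) w h N := by
  simp [slitSum, map_treeWeight]

@[simp] theorem slitSum_zero_right (q : R) (w h : ℕ) : slitSum q w h 0 = 1 := by
  simp [slitSum, treeWeight]

theorem slitSum_zero_succ (q : R) (h N : ℕ) : slitSum q 0 h (N + 1) = 0 := by
  refine Finset.sum_eq_zero fun x hx => ?_
  rw [BinaryTree.mem_treesOfNumNodesEq] at hx
  cases x with
  | nil => simp at hx
  | node _ l r => simp [treeWeight]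

/-- First-return decomposition: the left subtree is the path under the first arch, one level higher
in a slit narrower by one; the right subtree is what follows. The arch contributes its up step from
h and its down step from h + 1. -/
theorem slitSum_succ_succ (q : R) (w h N : ℕ) :
    slitSum q (w + 1) h (N + 1) =
      (∑ j ∈ Finset.range (h + 1), q ^ j) * (∑ j ∈ Finset.range (h + 2), q ^ j) *
      ∑ ij ∈ Finset.HasAntidiagonal.antidiagonal N,
        slitSum q w (h + 1) ij.1 * slitSum q (w + 1) h ij.2 := by
  obtain ⟨c, hc⟩ : ∃ c, c = (∑ j ∈ Finset.range (h + 1), q ^ j) *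
    ∑ j ∈ Finset.range (h + 2), q ^ j := ⟨_, rfl⟩
  rw [← hc, slitSum, BinaryTree.treesOfNumNodesEq_succ, Finset.sum_biUnion, Finset.mul_sum]
  · refine Finset.sum_congr rfl fun ij _ => ?_
    rw [Finset.sum_map, Finset.sum_product, slitSum, slitSum, Finset.sum_mul_sum, Finset.mul_sum]
    refine Finset.sum_congr rfl fun x _ => ?_
    rw [Finset.mul_sum]
    refine Finset.sum_congr rfl fun y _ => ?_
    rw [hc, ← mul_assoc]
    rfl
  · intro a _ b _ hab
    refine Finset.disjoint_left.2 fun x hx hx' => hab ?_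
    rw [Finset.mem_map] at hx hx'
    obtain ⟨y, hy, rfl⟩ := hx
    obtain ⟨z, hz, he⟩ := hx'
    obtain rfl : z = y := by simpa using he
    rw [Finset.mem_product, BinaryTree.mem_treesOfNumNodesEq,
      BinaryTree.mem_treesOfNumNodesEq] at hy hz
    exact Prod.ext (hy.1.symm.trans hz.1) (hy.2.symm.trans hz.2)

/-- A tree with `N` nodes fits into every slit of width at least `N`. -/
theorem treeWeight_eq_of_le (q : R) (x : BinaryTree Unit) :
    ∀ w h, x.numNodes ≤ w → treeWeight q w h x = treeWeight q x.numNodes h x := by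
  induction x with
  | nil => intro w h _; simp [treeWeight]
  | node _ l r ihl ihr =>
    intro w h hw
    simp only [BinaryTree.numNodes] at hw ⊢
    obtain ⟨w, rfl⟩ : ∃ v, w = v + 1 := ⟨w - 1, by omega⟩
    simp only [treeWeight]
    rw [ihl w, ihl (l.numNodes + r.numNodes), ihr (w + 1), ihr (l.numNodes + r.numNodes + 1)] <;>
      omega

theorem slitSum_eq_of_le (q : R) {w h N : ℕ} (hw : N ≤ w) : slitSum q w h N = slitSum q N h N := by
  refine Finset.sum_congr rfl fun x hx => ?_
  rw [BinaryTree.mem_treesOfNumNodesEq] at hx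
  subst hx
  exact treeWeight_eq_of_le q x w h hw

/-- The tail `l` makes the induction possible, since the two subtrees are read consecutively. The
ceiling is absolute in `pathWeight` and relative to h in `treeWeight`. -/
theorem pathWeight_ofTree_append (q : R) (x : BinaryTree Unit) : ∀ (w h : ℕ) (l : List DyckStep),
    pathWeight q (h + w) h ((DyckWord.ofTree x).toList ++ l) =
      treeWeight q w h x * pathWeight q (h + w) h l := by
  induction x with
  | nil =>
    intro w h l
    rw [DyckWord.ofTree, DyckWord.toList_eq_nil.2 rfl]
    simp [treeWeight]
  | node _ x y ihx ihy =>
    intro w h l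
    have hl : (DyckWord.ofTree (.node () x y)).toList ++ l = DyckStep.U ::
        ((DyckWord.ofTree x).toList ++ DyckStep.D :: ((DyckWord.ofTree y).toList ++ l)) := by
      rw [DyckWord.ofTree]
      change ([DyckStep.U] ++ _ ++ [DyckStep.D]) ++ _ ++ l = _
      simp
    rw [hl]
    cases w with
    | zero => simp [treeWeight, pathWeight]
    | succ w =>
      rw [pathWeight, if_pos (by omega), show h + (w + 1) = (h + 1) + w by ring, ihx, pathWeight,
        show (h + 1) + w = h + (w + 1) by ring, Nat.add_sub_cancel, ihy, treeWeight]
      ring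

/-- Unrolls the recursion into the product over steps that counts columns. The prefix hypothesis
keeps the path nonnegative, so the truncated subtractions are exact. -/
theorem pathWeight_eq (q : R) (b : ℕ) (l : List DyckStep) : ∀ h : ℕ, h ≤ b →
    (∀ i, (l.take i).count DyckStep.D ≤ h + (l.take i).count DyckStep.U) →
    pathWeight q b h l =
      open scoped Classical in
      if ∀ i, h + (l.take i).count DyckStep.U - (l.take i).count DyckStep.D ≤ b then
        ∏ i : Fin l.length, ∑ j ∈ Finset.range
          (h + (l.take i).count DyckStep.U - (l.take i).count DyckStep.D + 1), q ^ j
      else 0 := by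
  classical
  induction l with
  | nil => intro h hb _; simp [pathWeight, hb]
  | cons s l ih =>
    intro h hb hl
    have key : ∀ h' : ℕ, h' ≤ b → (∀ i, (l.take i).count DyckStep.D ≤
        h' + (l.take i).count DyckStep.U) →
        (∀ i, h + ((s :: l).take (i + 1)).count DyckStep.U -
          ((s :: l).take (i + 1)).count DyckStep.D =
          h' + (l.take i).count DyckStep.U - (l.take i).count DyckStep.D) →
        (∑ j ∈ Finset.range (h + 1), q ^ j) * pathWeight q b h' l =
          if ∀ i, h + ((s :: l).take i).count DyckStep.U - ((s :: l).take i).count DyckStep.D ≤ b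
          then ∏ i : Fin (s :: l).length, ∑ j ∈ Finset.range
            (h + ((s :: l).take i).count DyckStep.U -
              ((s :: l).take i).count DyckStep.D + 1), q ^ j
          else 0 := by
      intro h' hb' hl' he
      have hiff : (∀ i, h + ((s :: l).take i).count DyckStep.U -
          ((s :: l).take i).count DyckStep.D ≤ b) ↔
          ∀ i, h' + (l.take i).count DyckStep.U - (l.take i).count DyckStep.D ≤ b := by
        constructor
        · intro H i
          rw [← he]; exact H _
        · intro H i
          cases i with
          | zero => simpa using hb
          | succ i => rw [he]; exact H i
      rw [ih h' hb' hl', mul_ite, mul_zero]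
      simp only [hiff]
      refine if_congr Iff.rfl ?_ rfl
      rw [List.length_cons, Fin.prod_univ_succ]
      congr 1
      refine Finset.prod_congr rfl fun i _ => ?_
      rw [Fin.val_succ, he]
    cases s with
    | U =>
      rw [pathWeight]
      by_cases h1 : h + 1 ≤ b
      · rw [if_pos h1]
        refine key (h + 1) h1 (fun i => ?_) (fun i => ?_)
        · have := hl (i + 1)
          simp at this; omega
        · simp; omega
      · rw [if_neg h1, if_neg, mul_zero]
        intro H
        have := H 1
        simp at this; omega
    | D =>
      rw [pathWeight]
      have h0 := hl 1
      simp at h0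
      refine key (h - 1) (by omega) (fun i => ?_) (fun i => ?_)
      · have := hl (i + 1)
        simp at this; omega
      · simp; omega

end

/-! ### Path diagram counts as coefficients of slit sums -/

theorem pathWeight_toList {R : Type*} [CommSemiring R] (q : R) (w : ℕ) (p : DyckWord) :
    pathWeight q w 0 p.toList = treeWeight q w 0 p.toTree := by
  have := pathWeight_ofTree_append q p.toTree w 0 []
  simpa [pathWeight, DyckWord.ofTree_toTree] using this

/-- Expanding the product chooses one exponent per factor, that is, one admissible column vector. -/
theorem coeff_prod_geom_sum {n : ℕ} (b : Fin n → ℕ) (m : ℕ) :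
    (∏ i, ∑ j ∈ Finset.range (b i + 1), (Polynomial.X : Polynomial ℕ) ^ j).coeff m =
      Nat.card {c : Fin n → ℕ // (∀ i, c i ≤ b i) ∧ ∑ i, c i = m} := by
  rw [Finset.prod_univ_sum, Polynomial.finsetSum_coeff]
  simp_rw [Finset.prod_pow_eq_pow_sum, Polynomial.coeff_X_pow]
  rw [Finset.sum_boole, Nat.cast_id]
  symm
  refine Nat.subtype_card _ fun c => ?_
  simp [eq_comm]

theorem tangentPos_eq (s : DyckStep) (h : ℕ) : tangentPos s h = h := by
  cases s <;> rfl

theorem DyckWord.heightAt_le_semilength (p : DyckWord) (i : ℕ) : p.heightAt i ≤ p.semilength :=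
  (Nat.sub_le _ _).trans ((List.take_sublist _ _).count_le _)

/-- The path diagrams in a slit, sorted by their Dyck paths. -/
def slitDiagramEquiv (w N m : ℕ) :
    {d : PathDiagram tangentPos //
      d.path.semilength = N ∧ d.area = m ∧ ∀ i, d.path.heightAt i ≤ w} ≃
    Σ p : {p : DyckWord // p.semilength = N},
      {c : Fin p.1.toList.length → ℕ //
        ((∀ i, c i ≤ p.1.heightAt i) ∧ ∑ i, c i = m) ∧ ∀ i, p.1.heightAt i ≤ w} where
  toFun d := ⟨⟨d.1.path, d.2.1⟩, ⟨d.1.column,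
    ⟨fun i => (d.1.column_le i).trans_eq (tangentPos_eq _ _), d.2.2.1⟩, d.2.2.2⟩⟩
  invFun x := ⟨⟨x.1.1, x.2.1, fun i => (x.2.2.1.1 i).trans_eq (tangentPos_eq _ _).symm⟩,
    x.1.2, x.2.2.1.2, x.2.2.2⟩
  left_inv _ := rfl
  right_inv _ := rfl

theorem tangentSlitCount_eq_coeff (w N m : ℕ) :
    tangentSlitCount w N m = (slitSum (Polynomial.X : Polynomial ℕ) w 0 N).coeff m := by
  classical
  have hfin (p : {p : DyckWord // p.semilength = N}) :
      Finite {c : Fin p.1.toList.length → ℕ //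
        ((∀ i, c i ≤ p.1.heightAt i) ∧ ∑ i, c i = m) ∧ ∀ i, p.1.heightAt i ≤ w} :=
    Set.Finite.subset (Set.finite_Iic fun i : Fin p.1.toList.length => p.1.heightAt i)
      fun c hc => hc.1.1
  rw [tangentSlitCount, Nat.card_congr (slitDiagramEquiv w N m), Nat.card_sigma, slitSum,
    Polynomial.finsetSum_coeff, ← Finset.sum_coe_sort (BinaryTree.treesOfNumNodesEq N),
    ← (DyckWord.equivTreesOfNumNodesEq N).sum_comp]
  refine Finset.sum_congr rfl fun p _ => ?_
  rw [DyckWord.equivTreesOfNumNodesEq_apply_coe, ← pathWeight_toList,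
    pathWeight_eq _ _ _ _ (Nat.zero_le _) (fun i => by simpa using p.1.count_D_le_count_U i)]
  simp only [zero_add]
  change _ = (if ∀ i, p.1.heightAt i ≤ w then ∏ i : Fin p.1.toList.length,
    ∑ j ∈ Finset.range (p.1.heightAt i + 1), (Polynomial.X : Polynomial ℕ) ^ j else 0).coeff m
  split_ifs with h
  · rw [coeff_prod_geom_sum]
    simp [h]
  · simp [h]

theorem tangentCount_eq_coeff (N m : ℕ) :
    tangentCount N m = (slitSum (Polynomial.X : Polynomial ℕ) N 0 N).coeff m := by
  rw [← tangentSlitCount_eq_coeff, tangentCount, tangentSlitCount]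
  refine Nat.card_congr (Equiv.subtypeEquivRight fun d => ⟨fun h => ⟨h.1, h.2, fun i => ?_⟩,
    fun h => ⟨h.1, h.2.1⟩⟩)
  exact h.1 ▸ d.path.heightAt_le_semilength i

/-! ### The continued fraction of the q-tangent numbers -/

theorem qTangentFraction_succ_mul (k n : ℕ) :
    (1 - PowerSeries.C (qInteger k * qInteger (k + 1)) * PowerSeries.X ^ 2 *
      qTangentFraction (k + 1) n) * qTangentFraction k (n + 1) = 1 := by
  rw [qTangentFraction]
  exact PowerSeries.mul_invOfUnit _ 1 (by simp)

/-- Here `X` stands for t^2; the substitution is made later by `PowerSeries.expand 2`. -/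
theorem mk_slitSum_succ {R : Type*} [CommRing R] (q : R) (w h : ℕ) :
    (1 - PowerSeries.C ((∑ j ∈ Finset.range (h + 1), q ^ j) * ∑ j ∈ Finset.range (h + 2), q ^ j) *
      PowerSeries.X * PowerSeries.mk (slitSum q w (h + 1))) *
        PowerSeries.mk (slitSum q (w + 1) h) = 1 := by
  rw [sub_mul, one_mul, sub_eq_iff_eq_add]
  ext n
  rw [map_add, mul_assoc, mul_assoc, PowerSeries.coeff_C_mul, PowerSeries.coeff_mk]
  cases n with
  | zero => simp
  | succ n =>
    rw [PowerSeries.coeff_succ_X_mul, PowerSeries.coeff_mul, PowerSeries.coeff_one,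
      if_neg n.succ_ne_zero, zero_add, slitSum_succ_succ]
    simp only [PowerSeries.coeff_mk]

theorem qTangentFraction_eq_expand (w : ℕ) : ∀ h : ℕ,
    qTangentFraction (h + 1) w =
      PowerSeries.expand 2 two_ne_zero (PowerSeries.mk (slitSum Polynomial.X w h)) := by
  induction w with
  | zero =>
    intro h
    have : PowerSeries.mk (slitSum (Polynomial.X : Polynomial ℤ) 0 h) = 1 := by
      ext1 n
      cases n with
      | zero => simp
      | succ n => simp [slitSum_zero_succ, PowerSeries.coeff_one]
    rw [this, map_one, qTangentFraction]
  | succ w ih =>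
    intro h
    have h1 := qTangentFraction_succ_mul (h + 1) w
    have h2 := congrArg (PowerSeries.expand 2 two_ne_zero)
      (mk_slitSum_succ (Polynomial.X : Polynomial ℤ) w h)
    rw [map_mul, map_sub, map_mul, map_mul, PowerSeries.expand_C, PowerSeries.expand_X, map_one,
      ← ih] at h2
    exact (left_inv_eq_right_inv ((mul_comm _ _).trans h1) h2)

theorem qTangentNumber_eq_slitSum (N : ℕ) :
    qTangentNumber N = slitSum Polynomial.X N 0 N := by
  rw [qTangentNumber, PowerSeries.coeff_succ_X_mul, qTangentFraction_eq_expand,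
    PowerSeries.coeff_expand_mul, PowerSeries.coeff_mk]

/-! ### Geometric bounds, uniform in width and height -/

theorem catalan_le_four_pow (n : ℕ) : catalan n ≤ 4 ^ n := by
  rw [catalan_eq_centralBinom_div]
  calc n.centralBinom / (n + 1) ≤ n.centralBinom := Nat.div_le_self _ _
    _ ≤ 2 ^ (2 * n) := Nat.choose_le_two_pow _ _
    _ = 4 ^ n := by rw [pow_mul]; norm_num

section NormBounds
variable {𝕜 : Type*} [NormedField 𝕜] {q t : 𝕜}

theorem norm_geom_sum_le (hq : ‖q‖ < 1) (n : ℕ) :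
    ‖∑ j ∈ Finset.range n, q ^ j‖ ≤ (1 - ‖q‖)⁻¹ := by
  refine (norm_sum_le _ _).trans ?_
  simp_rw [norm_pow]
  rw [← tsum_geometric_of_lt_one (norm_nonneg q) hq]
  exact (summable_geometric_of_lt_one (norm_nonneg q) hq).sum_le_tsum _
    fun _ _ => pow_nonneg (norm_nonneg q) _

theorem norm_treeWeight_le (hq : ‖q‖ < 1) (x : BinaryTree Unit) :
    ∀ w h, ‖treeWeight q w h x‖ ≤ ((1 - ‖q‖)⁻¹ ^ 2) ^ x.numNodes := by
  have hB : 0 ≤ (1 - ‖q‖)⁻¹ := inv_nonneg.2 (sub_nonneg.2 hq.le)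
  induction x with
  | nil => intro w h; simp [treeWeight]
  | node _ l r ihl ihr =>
    intro w h
    cases w with
    | zero => simp only [treeWeight, norm_zero]; positivity
    | succ w =>
      simp only [treeWeight, BinaryTree.numNodes, norm_mul]
      calc _ ≤ (1 - ‖q‖)⁻¹ * (1 - ‖q‖)⁻¹ * ((1 - ‖q‖)⁻¹ ^ 2) ^ l.numNodes *
            ((1 - ‖q‖)⁻¹ ^ 2) ^ r.numNodes := by
            gcongr
            · exact norm_geom_sum_le hq _
            · exact norm_geom_sum_le hq _
            · exact ihl _ _
            · exact ihr _ _
        _ = _ := by rw [pow_succ, pow_add]; ring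

theorem norm_slitSum_mul_pow_le (hq : ‖q‖ < 1) (w h N : ℕ) :
    ‖slitSum q w h N * t ^ (2 * N)‖ ≤ ((2 * (‖t‖ * (1 - ‖q‖)⁻¹)) ^ 2) ^ N := by
  have h1 : ‖slitSum q w h N‖ ≤ 4 ^ N * ((1 - ‖q‖)⁻¹ ^ 2) ^ N := by
    refine (norm_sum_le_of_le (n := fun _ => ((1 - ‖q‖)⁻¹ ^ 2) ^ N) _ fun x hx => ?_).trans ?_
    · rw [BinaryTree.mem_treesOfNumNodesEq] at hx
      exact hx ▸ norm_treeWeight_le hq x w h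
    · rw [Finset.sum_const, BinaryTree.treesOfNumNodesEq_card_eq_catalan, nsmul_eq_mul]
      gcongr
      exact_mod_cast catalan_le_four_pow N
  rw [norm_mul, norm_pow]
  calc _ ≤ 4 ^ N * ((1 - ‖q‖)⁻¹ ^ 2) ^ N * ‖t‖ ^ (2 * N) := by gcongr
    _ = _ := by rw [pow_mul, ← mul_pow, ← mul_pow]; congr 1; ring

theorem two_mul_norm_lt_one (hq : ‖q‖ < 1) (ht : ‖t‖ < (1 - ‖q‖) / 2) :
    2 * (‖t‖ * (1 - ‖q‖)⁻¹) < 1 := by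
  have : 0 < 1 - ‖q‖ := sub_pos.2 hq
  rw [← mul_assoc, ← div_eq_mul_inv, div_lt_one this]
  linarith

theorem summable_geometric_bound (hq : ‖q‖ < 1) (ht : ‖t‖ < (1 - ‖q‖) / 2) :
    Summable fun N : ℕ => ((2 * (‖t‖ * (1 - ‖q‖)⁻¹)) ^ 2) ^ N := by
  have h0 : 0 ≤ 2 * (‖t‖ * (1 - ‖q‖)⁻¹) :=
    mul_nonneg zero_le_two (mul_nonneg (norm_nonneg _) (inv_nonneg.2 (sub_nonneg.2 hq.le)))
  exact summable_geometric_of_lt_one (sq_nonneg _)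
    (pow_lt_one₀ h0 (two_mul_norm_lt_one hq ht) two_ne_zero)

theorem summable_norm_slitSum (hq : ‖q‖ < 1) (ht : ‖t‖ < (1 - ‖q‖) / 2) (w : ℕ → ℕ) (h : ℕ) :
    Summable fun N => ‖slitSum q (w N) h N * t ^ (2 * N)‖ :=
  (summable_geometric_bound hq ht).of_nonneg_of_le (fun _ => norm_nonneg _)
    fun _ => norm_slitSum_mul_pow_le hq _ _ _

end NormBounds

/-! ### Analytic generating functions and the limit in the width -/

/-- The generating function of the slit sums. -/
noncomputable def slitSeries (q t : ℂ) (w h : ℕ) : ℂ := ∑' N, slitSum q w h N * t ^ (2 * N)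

/-- The generating function of the slit sums without restriction on the width. -/
noncomputable def pathSeries (q t : ℂ) (h : ℕ) : ℂ := ∑' N, slitSum q N h N * t ^ (2 * N)

section
variable {q t : ℂ}

theorem tendsto_slitSeries (hq : ‖q‖ < 1) (ht : ‖t‖ < (1 - ‖q‖) / 2) (h : ℕ) :
    Tendsto (fun w => slitSeries q t w h) atTop (𝓝 (pathSeries q t h)) := by
  refine tendsto_tsum_of_dominated_convergence (summable_geometric_bound hq ht) (fun N => ?_)
    (Eventually.of_forall fun w N => norm_slitSum_mul_pow_le hq w h N)
  refine tendsto_const_nhds.congr' ?_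
  filter_upwards [eventually_ge_atTop N] with w hw
  rw [slitSum_eq_of_le q hw]

theorem slitSeries_zero (h : ℕ) : slitSeries q t 0 h = 1 := by
  rw [slitSeries, tsum_eq_single 0]
  · simp
  · intro N hN
    obtain ⟨N, rfl⟩ := Nat.exists_eq_succ_of_ne_zero hN
    rw [Nat.succ_eq_add_one, slitSum_zero_succ, zero_mul]

theorem slitSeries_succ (hq : ‖q‖ < 1) (ht : ‖t‖ < (1 - ‖q‖) / 2) (w h : ℕ) :
    slitSeries q t (w + 1) h = 1 +
      ((∑ j ∈ Finset.range (h + 1), q ^ j) * (∑ j ∈ Finset.range (h + 2), q ^ j) * t ^ 2) *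
        (slitSeries q t w (h + 1) * slitSeries q t (w + 1) h) := by
  rw [slitSeries, slitSeries, tsum_mul_tsum_eq_tsum_sum_antidiagonal_of_summable_norm
      (summable_norm_slitSum hq ht (fun _ => w) (h + 1))
      (summable_norm_slitSum hq ht (fun _ => w + 1) h),
    (summable_norm_slitSum hq ht (fun _ => w + 1) h).of_norm.tsum_eq_zero_add, ← tsum_mul_left]
  congr 1
  · simp
  · refine tsum_congr fun N => ?_
    rw [slitSum_succ_succ, mul_assoc, mul_assoc (_ * _), Finset.sum_mul, Finset.mul_sum]
    congr 1
    rw [Finset.sum_mul]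
    refine Finset.sum_congr rfl fun ij hij => ?_
    rw [Finset.HasAntidiagonal.mem_antidiagonal] at hij
    rw [← hij]
    ring

theorem norm_geom_sum_mul_le (hq : ‖q‖ < 1) (ht : ‖t‖ < (1 - ‖q‖) / 2) (n : ℕ) :
    ‖(∑ j ∈ Finset.range n, q ^ j) * t‖ ≤ 1 / 2 := by
  rw [norm_mul]
  have := mul_le_mul_of_nonneg_right (norm_geom_sum_le hq n) (norm_nonneg t)
  linarith [two_mul_norm_lt_one hq ht, mul_comm ‖t‖ (1 - ‖q‖)⁻¹]

/-- The recursion gives ‖F‖ ≤ 1 + (1/2)(1/2)·2·‖F‖, so the bound 2 reproduces itself. It is exactly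
what makes the factor in the final contraction at most ‖l‖. -/
theorem norm_slitSeries_le (hq : ‖q‖ < 1) (ht : ‖t‖ < (1 - ‖q‖) / 2) (w : ℕ) :
    ∀ h, ‖slitSeries q t w h‖ ≤ 2 := by
  induction w with
  | zero => intro h; simp [slitSeries_zero]
  | succ w ih =>
    intro h
    have h1 := norm_geom_sum_mul_le hq ht (h + 1)
    have h2 := norm_geom_sum_mul_le hq ht (h + 2)
    have h3 := slitSeries_succ hq ht w h
    have h4 := ih (h + 1)
    set A := (∑ j ∈ Finset.range (h + 1), q ^ j) with hA
    set B := (∑ j ∈ Finset.range (h + 2), q ^ j) with hB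
    set F := slitSeries q t (w + 1) h
    set G := slitSeries q t w (h + 1)
    have h5 : ‖F‖ ≤ 1 + ‖A * t‖ * ‖B * t‖ * ‖G‖ * ‖F‖ := by
      conv_lhs => rw [h3]
      refine (norm_add_le _ _).trans ?_
      rw [norm_one, ← norm_mul, ← norm_mul, ← norm_mul]
      apply le_of_eq
      congr 2
      ring
    have h6 : ‖A * t‖ * ‖B * t‖ * ‖G‖ * ‖F‖ ≤ 1 / 2 * (1 / 2) * 2 * ‖F‖ := by gcongr
    linarith

theorem norm_pathSeries_le (hq : ‖q‖ < 1) (ht : ‖t‖ < (1 - ‖q‖) / 2) (h : ℕ) :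
    ‖pathSeries q t h‖ ≤ 2 :=
  le_of_tendsto' (tendsto_slitSeries hq ht h).norm fun w => norm_slitSeries_le hq ht w h

theorem pathSeries_eq (hq : ‖q‖ < 1) (ht : ‖t‖ < (1 - ‖q‖) / 2) (h : ℕ) :
    pathSeries q t h = 1 +
      ((∑ j ∈ Finset.range (h + 1), q ^ j) * (∑ j ∈ Finset.range (h + 2), q ^ j) * t ^ 2) *
        (pathSeries q t (h + 1) * pathSeries q t h) := by
  have h1 := (tendsto_add_atTop_iff_nat 1).2 (tendsto_slitSeries hq ht h)
  refine tendsto_nhds_unique h1 (.congr (fun w => (slitSeries_succ hq ht w h).symm) ?_)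
  exact (((tendsto_slitSeries hq ht (h + 1)).mul h1).const_mul _).const_add 1

theorem hasSum_coeff_slitSum {R : Type*} [NormedCommRing R] (q : R) (w h N : ℕ) (s : R) :
    HasSum (fun m => ((slitSum (Polynomial.X : Polynomial ℕ) w h N).coeff m : R) * s * q ^ m)
      (slitSum q w h N * s) := by
  have h1 : slitSum q w h N =
      (slitSum (Polynomial.X : Polynomial ℕ) w h N).eval₂ (Nat.castRingHom R) q := by
    rw [← Polynomial.coe_eval₂RingHom, map_slitSum, Polynomial.coe_eval₂RingHom,
      Polynomial.eval₂_X]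
  rw [h1, Polynomial.eval₂_eq_sum, Polynomial.sum, Finset.sum_mul]
  have h2 := hasSum_sum_of_ne_finset_zero (L := SummationFilter.unconditional ℕ)
    (s := (slitSum (Polynomial.X : Polynomial ℕ) w h N).support)
    (f := fun m => ((slitSum (Polynomial.X : Polynomial ℕ) w h N).coeff m : R) * s * q ^ m)
    fun m hm => by simp [Polynomial.notMem_support_iff.1 hm]
  convert h2 using 1
  simp only [eq_natCast, mul_right_comm]

/-- The coefficients are natural numbers, so absolute convergence is the same statement at ‖q‖, ‖t‖.
The width may depend on N: the identity gives all paths, a constant gives a slit. -/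
theorem hasSum_slit_prod (hq : ‖q‖ < 1) (ht : ‖t‖ < (1 - ‖q‖) / 2) (w : ℕ → ℕ) :
    HasSum (fun p : ℕ × ℕ => ((slitSum (Polynomial.X : Polynomial ℕ) (w p.1) 0 p.1).coeff p.2 : ℂ) *
      t ^ (2 * p.1) * q ^ p.2) (∑' N, slitSum q (w N) 0 N * t ^ (2 * N)) := by
  have hs : Summable (fun p : ℕ × ℕ =>
      ((slitSum (Polynomial.X : Polynomial ℕ) (w p.1) 0 p.1).coeff p.2 : ℂ) *
        t ^ (2 * p.1) * q ^ p.2) := by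
    apply Summable.of_norm
    have h1 (N : ℕ) := hasSum_coeff_slitSum ‖q‖ (w N) 0 N (‖t‖ ^ (2 * N))
    simp_rw [norm_mul, norm_pow, Complex.norm_natCast]
    refine (summable_prod_of_nonneg fun p => by positivity).2 ⟨fun N => (h1 N).summable, ?_⟩
    simp_rw [fun N => (h1 N).tsum_eq]
    exact (summable_norm_slitSum (q := ‖q‖) (t := ‖t‖) (by simpa using hq) (by simpa using ht)
      w 0).of_norm
  have h2 := hs.hasSum.prod_fiberwise fun N => hasSum_coeff_slitSum q (w N) 0 N (t ^ (2 * N))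
  rw [h2.tsum_eq]
  exact hs.hasSum

end

/-! ### The Heine-type series and its contiguous relation -/

section
variable {q a : ℂ}

/-- The product of `(1 - q ^ (n + j)) / (1 - a q ^ (n + j))` over `1 ≤ j ≤ k`. -/
noncomputable def pochRatio (q a : ℂ) (k n : ℕ) : ℂ :=
  ∏ j ∈ Finset.range k, (1 - q ^ (n + j + 1)) / (1 - a * q ^ (n + j + 1))

/-- The sum of `(-a) ^ n` times `pochRatio q a k n`, a `₂φ₁` series up to normalization. -/
noncomputable def heineSum (q a : ℂ) (k : ℕ) : ℂ := ∑' n, (-a) ^ n * pochRatio q a k n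

theorem one_sub_pow_ne_zero (hq : ‖q‖ < 1) (n : ℕ) : 1 - q ^ (n + 1) ≠ 0 := by
  intro h
  have : ‖q ^ (n + 1)‖ < 1 := by
    rw [norm_pow]; exact pow_lt_one₀ (norm_nonneg _) hq n.succ_ne_zero
  rw [← sub_eq_zero.1 h, norm_one] at this
  exact lt_irrefl _ this

theorem one_sub_mul_pow_ne_zero (hq : ‖q‖ < 1) (ha : ‖a‖ < 1) (n : ℕ) : 1 - a * q ^ n ≠ 0 := by
  intro h
  have : ‖a * q ^ n‖ < 1 := by
    rw [norm_mul, norm_pow]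
    exact mul_lt_one_of_nonneg_of_lt_one_left (norm_nonneg _) ha
      (pow_le_one₀ (norm_nonneg _) hq.le)
  rw [← sub_eq_zero.1 h, norm_one] at this
  exact lt_irrefl _ this

theorem le_norm_one_sub_mul_pow (hq : ‖q‖ < 1) (n : ℕ) : 1 - ‖a‖ ≤ ‖1 - a * q ^ n‖ := by
  have h1 := norm_sub_norm_le (1 : ℂ) (a * q ^ n)
  have h2 : ‖a‖ * ‖q‖ ^ n ≤ ‖a‖ :=
    mul_le_of_le_one_right (norm_nonneg _) (pow_le_one₀ (norm_nonneg _) hq.le)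
  rw [norm_one, norm_mul, norm_pow] at h1
  linarith

/-- The exponential form turns the product in `pochRatio` into a geometric sum, hence a bound
uniform in k and n. -/
theorem norm_one_sub_div_le (hq : ‖q‖ < 1) (ha : ‖a‖ < 1) (n : ℕ) :
    ‖(1 - q ^ n) / (1 - a * q ^ n)‖ ≤ Real.exp (2 / (1 - ‖a‖) * ‖q‖ ^ n) := by
  have h1 : 0 < 1 - ‖a‖ := sub_pos.2 ha
  have h2 := le_norm_one_sub_mul_pow (a := a) hq n
  have h3 : (1 - q ^ n) / (1 - a * q ^ n) = 1 + (a - 1) * q ^ n / (1 - a * q ^ n) := by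
    rw [one_add_div (one_sub_mul_pow_ne_zero hq ha n)]
    ring
  have h4 : ‖a - 1‖ ≤ 2 := (norm_sub_le _ _).trans (by rw [norm_one]; linarith)
  rw [h3]
  calc _ ≤ ‖(1 : ℂ)‖ + ‖(a - 1) * q ^ n / (1 - a * q ^ n)‖ := norm_add_le _ _
    _ ≤ 1 + 2 * ‖q‖ ^ n / (1 - ‖a‖) := by
      rw [norm_one, norm_div, norm_mul, norm_pow]
      gcongr
    _ = 2 / (1 - ‖a‖) * ‖q‖ ^ n + 1 := by ring
    _ ≤ _ := Real.add_one_le_exp _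

theorem norm_pochRatio_le (hq : ‖q‖ < 1) (ha : ‖a‖ < 1) (k n : ℕ) :
    ‖pochRatio q a k n‖ ≤ Real.exp (2 / (1 - ‖a‖) * (1 - ‖q‖)⁻¹) := by
  rw [pochRatio, norm_prod]
  calc _ ≤ ∏ j ∈ Finset.range k, Real.exp (2 / (1 - ‖a‖) * ‖q‖ ^ (n + j + 1)) :=
        Finset.prod_le_prod (fun _ _ => norm_nonneg _) fun j _ => norm_one_sub_div_le hq ha _
    _ = Real.exp (2 / (1 - ‖a‖) * ∑ j ∈ Finset.range k, ‖q‖ ^ (n + j + 1)) := by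
        rw [← Real.exp_sum, Finset.mul_sum]
    _ ≤ _ := by
        have : 0 < 1 - ‖a‖ := sub_pos.2 ha
        gcongr
        rw [← tsum_geometric_of_lt_one (norm_nonneg q) hq]
        refine le_trans (Finset.sum_le_sum fun j _ => ?_)
          ((summable_geometric_of_lt_one (norm_nonneg q) hq).sum_le_tsum (Finset.range k)
            fun _ _ => pow_nonneg (norm_nonneg q) _)
        exact pow_le_pow_of_le_one (norm_nonneg _) hq.le (by omega)

theorem norm_heineSum_term_le (hq : ‖q‖ < 1) (ha : ‖a‖ < 1) (k n : ℕ) :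
    ‖(-a) ^ n * pochRatio q a k n‖ ≤
      ‖a‖ ^ n * Real.exp (2 / (1 - ‖a‖) * (1 - ‖q‖)⁻¹) := by
  rw [norm_mul, norm_pow, norm_neg]
  gcongr
  exact norm_pochRatio_le hq ha k n

theorem summable_heineSum (hq : ‖q‖ < 1) (ha : ‖a‖ < 1) (k : ℕ) :
    Summable fun n => (-a) ^ n * pochRatio q a k n :=
  .of_norm_bounded ((summable_geometric_of_lt_one (norm_nonneg _) ha).mul_right _)
    (norm_heineSum_term_le hq ha k)

theorem norm_heineSum_le (hq : ‖q‖ < 1) (ha : ‖a‖ < 1) (k : ℕ) :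
    ‖heineSum q a k‖ ≤ (1 - ‖a‖)⁻¹ * Real.exp (2 / (1 - ‖a‖) * (1 - ‖q‖)⁻¹) :=
  tsum_of_norm_bounded ((hasSum_geometric_of_lt_one (norm_nonneg _) ha).mul_right _)
    (norm_heineSum_term_le hq ha k)

theorem pochRatio_succ (k n : ℕ) : pochRatio q a (k + 1) n =
    pochRatio q a k n * ((1 - q ^ (n + k + 1)) / (1 - a * q ^ (n + k + 1))) := by
  rw [pochRatio, Finset.prod_range_succ, pochRatio]

theorem pochRatio_succ' (k n : ℕ) : pochRatio q a (k + 1) n =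
    ((1 - q ^ (n + 1)) / (1 - a * q ^ (n + 1))) * pochRatio q a k (n + 1) := by
  rw [pochRatio, Finset.prod_range_succ', pochRatio, mul_comm]
  congr 1
  refine Finset.prod_congr rfl fun j _ => ?_
  rw [show n + (j + 1) + 1 = n + 1 + j + 1 by ring]

/-- The telescoping identity behind the contiguous relation. -/
theorem pochRatio_telescope (hq : ‖q‖ < 1) (ha : ‖a‖ < 1) (k n : ℕ) :
    (1 - a ^ 2) * pochRatio q a (k + 1) n -
        (1 - q ^ (k + 1)) * (pochRatio q a k n - a ^ 2 * pochRatio q a (k + 2) n) =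
      q ^ (k + 1) * (1 - a) * ((1 - q ^ n) / (1 - a * q ^ (n + k + 1)) * pochRatio q a k n +
        a * ((1 - q ^ (n + 1)) / (1 - a * q ^ (n + 1 + k + 1)) * pochRatio q a k (n + 1))) := by
  have h1 := one_sub_mul_pow_ne_zero hq ha (n + k + 1)
  have h2 := one_sub_mul_pow_ne_zero hq ha (n + 1 + k + 1)
  have h3 := one_sub_mul_pow_ne_zero hq ha (n + 1)
  have e1 := pochRatio_succ (q := q) (a := a) k n
  have e2 := pochRatio_succ (q := q) (a := a) (k + 1) n
  have e3 : (1 - q ^ (n + 1)) * pochRatio q a k (n + 1) =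
      pochRatio q a (k + 1) n * (1 - a * q ^ (n + 1)) := by
    rw [pochRatio_succ', div_mul_eq_mul_div, div_mul_cancel₀ _ h3]
  rw [show n + (k + 1) + 1 = n + 1 + k + 1 by ring] at e2
  rw [div_mul_eq_mul_div, div_mul_eq_mul_div, e3, e2, e1]
  have p1 : q ^ (n + k + 1) = q ^ n * q ^ (k + 1) := by ring
  have p2 : q ^ (n + 1 + k + 1) = q * (q ^ n * q ^ (k + 1)) := by ring
  have p3 : q ^ (n + 1) = q * q ^ n := by ring
  rw [p1] at h1 ⊢
  rw [p2] at h2 ⊢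
  rw [p3]
  generalize q ^ n = x at *
  generalize q ^ (k + 1) = Q at *
  generalize pochRatio q a k n = P
  obtain ⟨c, hc⟩ : ∃ c, c = 1 - a * (x * Q) := ⟨_, rfl⟩
  obtain ⟨d, hd⟩ : ∃ d, d = 1 - a * (q * (x * Q)) := ⟨_, rfl⟩
  rw [← hc] at h1 ⊢
  rw [← hd] at h2 ⊢
  field_simp
  rw [hc, hd]
  ring

/-- The contiguous relation of `heineSum`. -/
theorem heineSum_contiguous (hq : ‖q‖ < 1) (ha : ‖a‖ < 1) (k : ℕ) :
    (1 - a ^ 2) * heineSum q a (k + 1) =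
      (1 - q ^ (k + 1)) * (heineSum q a k - a ^ 2 * heineSum q a (k + 2)) := by
  -- By `pochRatio_telescope` the termwise defect of the relation is g n - g (n + 1); the sum is g
  -- 0, which vanishes through the factor 1 - q ^ 0.
  set g : ℕ → ℂ := fun n => (-a) ^ n * (q ^ (k + 1) * (1 - a) *
    ((1 - q ^ n) / (1 - a * q ^ (n + k + 1)) * pochRatio q a k n)) with hg
  have hsum := (((summable_heineSum hq ha (k + 1)).hasSum.mul_left (1 - a ^ 2)).sub
    (((summable_heineSum hq ha k).hasSum.sub
      ((summable_heineSum hq ha (k + 2)).hasSum.mul_left (a ^ 2))).mul_left (1 - q ^ (k + 1))))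
  have hterm : ∀ n, (1 - a ^ 2) * ((-a) ^ n * pochRatio q a (k + 1) n) -
      (1 - q ^ (k + 1)) * ((-a) ^ n * pochRatio q a k n -
        a ^ 2 * ((-a) ^ n * pochRatio q a (k + 2) n)) = g n - g (n + 1) := by
    intro n
    have := pochRatio_telescope hq ha k n
    simp only [hg, pow_succ (-a)]
    linear_combination (-a) ^ n * this
  have hbd : Summable g := by
    have h1 : 0 < 1 - ‖a‖ := sub_pos.2 ha
    refine .of_norm_bounded (((summable_geometric_of_lt_one (norm_nonneg _) ha).mul_right
      (‖q ^ (k + 1) * (1 - a)‖ * (2 / (1 - ‖a‖) *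
        Real.exp (2 / (1 - ‖a‖) * (1 - ‖q‖)⁻¹))))) fun n => ?_
    have h2 : ‖1 - q ^ n‖ ≤ 2 := by
      refine (norm_sub_le _ _).trans ?_
      rw [norm_one, norm_pow]
      linarith [pow_le_one₀ (n := n) (norm_nonneg q) hq.le]
    simp only [hg]
    rw [norm_mul, norm_mul, norm_mul ((1 - q ^ n) / _), norm_div, norm_pow (-a), norm_neg]
    gcongr
    · exact le_norm_one_sub_mul_pow hq _
    · exact norm_pochRatio_le hq ha k n
  simp only [hterm] at hsum
  have h0 : ∑' n, (g n - g (n + 1)) = 0 := by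
    rw [hbd.tsum_sub ((summable_nat_add_iff 1).2 hbd), hbd.tsum_eq_zero_add]
    simp [hg]
  have := hsum.tsum_eq.symm.trans h0
  simp only [heineSum]
  linear_combination this
end

theorem heineSum_zero {q a : ℂ} (ha : ‖a‖ < 1) : heineSum q a 0 = (1 + a)⁻¹ := by
  simp only [heineSum, pochRatio, Finset.range_zero, Finset.prod_empty, mul_one]
  rw [tsum_geometric_of_norm_lt_one (by rwa [norm_neg]), sub_neg_eq_add]

theorem summable_closedForm {q a : ℂ} (hq : ‖q‖ < 1) (ha : ‖a‖ < 1) :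
    Summable fun k : ℕ => (-a) ^ k / (1 - a * q ^ k) := by
  have h1 : 0 < 1 - ‖a‖ := sub_pos.2 ha
  refine .of_norm_bounded ((summable_geometric_of_lt_one (norm_nonneg _) ha).div_const (1 - ‖a‖))
    fun n => ?_
  rw [norm_div, norm_pow, norm_neg]
  gcongr
  exact le_norm_one_sub_mul_pow hq _

/-- Partial fractions: a(1-x)/(1-ax) = 1 - (1-a)/(1-ax) with x = q^(n+1), leaving a geometric series
and a shift of the closed-form series. -/
theorem heineSum_one {q a : ℂ} (hq : ‖q‖ < 1) (ha : ‖a‖ < 1) (ha0 : a ≠ 0) :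
    (1 + a) * heineSum q a 1 * a ^ 2 =
      (1 - a ^ 2) * (∑' k : ℕ, (-a) ^ k / (1 - a * q ^ k)) - 1 := by
  have hs := summable_closedForm hq ha
  have h1a : 1 - a ≠ 0 := by simpa using one_sub_mul_pow_ne_zero hq ha 0
  have h1a' : 1 + a ≠ 0 := by simpa using one_sub_mul_pow_ne_zero (a := -a) hq (by simpa using ha) 0
  have h1 : ∀ n : ℕ, (-a) ^ n * pochRatio q a 1 n * a ^ 2 =
      a * (-a) ^ n + (1 - a) * ((-a) ^ (n + 1) / (1 - a * q ^ (n + 1))) := by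
    intro n
    have := one_sub_mul_pow_ne_zero hq ha (n + 1)
    simp only [pochRatio, Finset.prod_range_one, add_zero, pow_succ (-a)]
    field_simp
    ring
  have h2 := ((hasSum_geometric_of_norm_lt_one (ξ := -a) (by rwa [norm_neg])).mul_left a).add
    (((summable_nat_add_iff 1).2 hs).hasSum.mul_left (1 - a))
  simp only [← h1] at h2
  have h3 := ((summable_heineSum hq ha 1).hasSum.mul_right (a ^ 2)).unique h2
  rw [hs.tsum_eq_zero_add, heineSum, mul_assoc, h3, sub_neg_eq_add]
  simp only [pow_zero, mul_one]
  field_simp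
  ring

/-! ### Identification with the closed form -/

section
variable {q t l : ℂ}

/-- The roots have product 1, so minimality gives ‖l‖ ≤ 1. Equality would force ‖1 - q‖ ≤ 2‖t‖ < 1 -
‖q‖, which is impossible. -/
theorem norm_lt_one_of_min (ht0 : t ≠ 0) (ht : ‖t‖ < (1 - ‖q‖) / 2)
    (hroot : l ^ 2 - l * (1 - q) / t + 1 = 0)
    (hmin : ∀ r : ℂ, r ^ 2 - r * (1 - q) / t + 1 = 0 → ‖l‖ ≤ ‖r‖) : ‖l‖ < 1 := by
  have hl : l ≠ 0 := by
    rintro rfl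
    simp at hroot
  have h1 : ‖l‖ ≤ ‖l⁻¹‖ := by
    apply hmin
    field_simp at hroot ⊢
    linear_combination hroot
  rw [norm_inv] at h1
  have hpos := norm_pos_iff.2 hl
  have h2 : ‖l‖ ≤ 1 := by
    rw [← one_div, le_div_iff₀ hpos] at h1
    nlinarith
  refine lt_of_le_of_ne h2 fun h3 => ?_
  have h4 : l * (1 - q) = (l ^ 2 + 1) * t := by
    field_simp at hroot
    linear_combination -hroot
  have h5 := congrArg norm h4
  rw [norm_mul, norm_mul, h3, one_mul] at h5
  have h6 : ‖l ^ 2 + 1‖ ≤ 2 := by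
    refine (norm_add_le _ _).trans ?_
    rw [norm_pow, h3, norm_one]
    norm_num
  have h7 : 1 - ‖q‖ ≤ ‖1 - q‖ := by simpa using norm_sub_norm_le (1 : ℂ) q
  nlinarith [norm_nonneg t]

/-- The quotients of consecutive values of `heineSum` solve the recursion of the continued
fraction. -/
theorem pathSeries_mul_heineSum (hq : ‖q‖ < 1) (ht : ‖t‖ < (1 - ‖q‖) / 2) (hl : ‖l‖ < 1)
    (hlt : l * (1 - q) = (1 + l ^ 2) * t) :
    pathSeries q t 0 * (1 - q) * heineSum q (Complex.I * l) 0 =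
      (1 + l ^ 2) * heineSum q (Complex.I * l) 1 := by
  set W := heineSum q (Complex.I * l) with hW
  have ha : ‖Complex.I * l‖ < 1 := by simpa using hl
  set D : ℕ → ℂ := fun h =>
    pathSeries q t h * (1 - q ^ (h + 1)) * W h - (1 + l ^ 2) * W (h + 1) with hD
  have hgeom (n : ℕ) : (∑ j ∈ Finset.range n, q ^ j) * (1 - q) = 1 - q ^ n := by
    linear_combination -(geom_sum_mul q n)
  have hstep (h : ℕ) :
      D h = l * ((∑ j ∈ Finset.range (h + 1), q ^ j) * t) * pathSeries q t h * D (h + 1) := by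
    have h1 := pathSeries_eq hq ht h
    have h2 := heineSum_contiguous hq ha h
    rw [← hW] at h2
    have h3 := hgeom (h + 1)
    have h4 := hgeom (h + 2)
    have hI : Complex.I ^ 2 = -1 := Complex.I_sq
    rw [mul_pow, hI] at h2
    simp only [hD]
    rw [← h3, show h + 1 + 1 = h + 2 from rfl, ← h4]
    rw [← h3] at h2
    generalize (∑ j ∈ Finset.range (h + 1), q ^ j) = A at *
    generalize (∑ j ∈ Finset.range (h + 2), q ^ j) = B at *
    generalize pathSeries q t (h + 1) = G at *
    generalize pathSeries q t h = F at *
    -- Contiguous relation, path recursion and quadratic equation for l, in this order; `hlt` trades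
    -- t for l.
    linear_combination -F * h2 + (1 + l ^ 2) * W (h + 1) * h1 -
      A * F * (B * t * G * W (h + 1) + l * W (h + 2)) * hlt
  obtain ⟨C, hC⟩ : ∃ C, ∀ h, ‖W h‖ ≤ C := ⟨_, norm_heineSum_le hq ha⟩
  have hbound (h : ℕ) : ‖D h‖ ≤ 2 * 2 * C + 2 * C := by
    simp only [hD]
    refine (norm_sub_le _ _).trans ?_
    rw [norm_mul, norm_mul, norm_mul]
    have hC0 : 0 ≤ C := (norm_nonneg _).trans (hC 0)
    gcongr
    · exact norm_pathSeries_le hq ht h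
    · refine (norm_sub_le _ _).trans ?_
      rw [norm_one, norm_pow]
      linarith [pow_le_one₀ (n := h + 1) (norm_nonneg q) hq.le]
    · exact hC h
    · refine (norm_add_le _ _).trans ?_
      rw [norm_one, norm_pow]
      linarith [pow_le_one₀ (n := 2) (norm_nonneg l) hl.le]
    · exact hC _
  have hcontr (h : ℕ) : ‖D h‖ ≤ ‖l‖ * ‖D (h + 1)‖ := by
    rw [hstep, norm_mul, norm_mul, norm_mul]
    -- The 1/2 bounds [h+1]t and the 2 bounds the path series.
    calc _ ≤ ‖l‖ * (1 / 2) * 2 * ‖D (h + 1)‖ := by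
          gcongr
          · exact norm_geom_sum_mul_le hq ht _
          · exact norm_pathSeries_le hq ht h
      _ = _ := by ring
  have hiter (n : ℕ) : ‖D 0‖ ≤ ‖l‖ ^ n * ‖D n‖ := by
    induction n with
    | zero => simp
    | succ n ih =>
      refine ih.trans ?_
      rw [pow_succ, mul_assoc]
      gcongr
      exact hcontr n
  have hlim : Tendsto (fun n : ℕ => ‖l‖ ^ n * (2 * 2 * C + 2 * C)) atTop (𝓝 0) := by
    simpa using (tendsto_pow_atTop_nhds_zero_of_lt_one (norm_nonneg l) hl).mul_const
      (2 * 2 * C + 2 * C)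
  have h0 : ‖D 0‖ ≤ 0 := ge_of_tendsto' hlim fun n =>
    (hiter n).trans (mul_le_mul_of_nonneg_left (hbound n) (by positivity))
  have h1 : D 0 = 0 := norm_le_zero_iff.1 h0
  simp only [hD, zero_add, pow_one] at h1
  exact sub_eq_zero.1 h1

theorem pathSeries_zero_eq_closedForm (hq : ‖q‖ < 1) (ht0 : t ≠ 0) (ht : ‖t‖ < (1 - ‖q‖) / 2)
    (hl : ‖l‖ < 1) (hlt : l * (1 - q) = (1 + l ^ 2) * t) :
    pathSeries q t 0 = qTangentClosedForm q l := by
  have hl0 : l ≠ 0 := by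
    rintro rfl
    apply ht0
    simpa using hlt.symm
  have hq1 : 1 - q ≠ 0 := by simpa using one_sub_pow_ne_zero hq 0
  have ha : ‖Complex.I * l‖ < 1 := by simpa using hl
  have h1 := pathSeries_mul_heineSum hq ht hl hlt
  have h2 := heineSum_one hq ha (mul_ne_zero Complex.I_ne_zero hl0)
  have h3 : 1 + Complex.I * l ≠ 0 := by
    simpa using one_sub_mul_pow_ne_zero (a := -(Complex.I * l)) hq (by simpa using hl) 0
  rw [heineSum_zero ha] at h1
  rw [mul_pow, Complex.I_sq] at h2
  rw [qTangentClosedForm, neg_mul, eq_div_iff (mul_ne_zero (pow_ne_zero 2 hl0) hq1)]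
  generalize (∑' k : ℕ, (-(Complex.I * l)) ^ k / (1 - Complex.I * l * q ^ k)) = S at *
  rw [← div_eq_mul_inv, div_eq_iff h3] at h1
  linear_combination l ^ 2 * h1 - (1 + l ^ 2) * h2

end

theorem corollary1 (q t l : ℂ) (hq : ‖q‖ < 1) (ht0 : t ≠ 0) (ht : ‖t‖ < (1 - ‖q‖) / 2)
    -- `l` is the root of smallest modulus of the quadratic equation
    (hroot : l ^ 2 - l * (1 - q) / t + 1 = 0)
    (hmin : ∀ r : ℂ, r ^ 2 - r * (1 - q) / t + 1 = 0 → ‖l‖ ≤ ‖r‖) :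
    -- the series in the closed form converges
    Summable (fun k : ℕ => (-Complex.I * l) ^ k / (1 - Complex.I * l * q ^ k)) ∧
    -- the generating function of all path diagrams
    HasSum (fun p : ℕ × ℕ => (tangentCount p.1 p.2 : ℂ) * t ^ (2 * p.1) * q ^ p.2)
      (qTangentClosedForm q l) ∧
    -- the generating function of the `q`-tangent numbers
    HasSum (fun N : ℕ => Polynomial.aeval q (qTangentNumber N) * t ^ (2 * N))
      (qTangentClosedForm q l) ∧
    -- the limit of the generating functions in slits of width `w`
    (∀ w : ℕ, Summable
      (fun p : ℕ × ℕ => (tangentSlitCount w p.1 p.2 : ℂ) * t ^ (2 * p.1) * q ^ p.2)) ∧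
    Filter.Tendsto
      (fun w : ℕ => ∑' p : ℕ × ℕ, (tangentSlitCount w p.1 p.2 : ℂ) * t ^ (2 * p.1) * q ^ p.2)
      Filter.atTop (nhds (qTangentClosedForm q l)) := by
  have hl := norm_lt_one_of_min ht0 ht hroot hmin
  have hlt : l * (1 - q) = (1 + l ^ 2) * t := by
    field_simp at hroot
    linear_combination -hroot
  rw [← pathSeries_zero_eq_closedForm hq ht0 ht hl hlt]
  simp only [tangentCount_eq_coeff, tangentSlitCount_eq_coeff]
  refine ⟨?_, hasSum_slit_prod hq ht id, ?_, fun w => (hasSum_slit_prod hq ht fun _ => w).summable,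
    ?_⟩
  · rw [neg_mul]
    exact summable_closedForm hq (by simpa using hl)
  · have h1 (N : ℕ) : Polynomial.aeval q (qTangentNumber N) = slitSum q N 0 N := by
      rw [qTangentNumber_eq_slitSum, ← RingHom.coe_coe, map_slitSum, RingHom.coe_coe,
        Polynomial.aeval_X]
    simp only [h1]
    exact (summable_norm_slitSum hq ht id 0).of_norm.hasSum
  · simp_rw [fun w : ℕ => (hasSum_slit_prod hq ht fun _ => w).tsum_eq]
    exact tendsto_slitSeries hq ht 0
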